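/- Let $S$ be a countable state space, $A$ an action set with $|A|=2$, $\Pi$ a set of policies $\pi:S\to A$, $\beta$ a fixed probability distribution on $S$, and $T\in\{1,2,\dots\}$ a known horizon. **Protocol.** Let $0\notin A$ be a dummy action. A history is a finite sequence of triples in $S\times A\times(A\cup\{0\})$. An adversary $V$ maps every history to a probability distribution on $S\times A$. An algorithm $\Gamma$ consists of a query rule $\Gamma^Q$, which maps a history and a state to a distribution on $\{0,1\}$, and an action rule $\Gamma^A$, which maps a history, a state and a query result in $A\cup\{0\}$ to a distribution on $A$. In round $t=1,\dots,T$, given the history $F_t=(s_i,a_i,a_i^mq_i)_{i<t}$, the adversary draws a state and correct action $(s_t,a_t^m)\sim V(F_t)$, the algorithm draws its query decision $q_t\sim\Gamma^Q(F_t,s_t)$ and then its action $a_t\sim\Gamma^A(F_t,s_t,a_t^mq_t)$; here $a_t^mq_t$ is $a_t^m$ if $q_t=1$ and the dummy action $0$ if $q_t=0$. The algorithm is query-agnostic if $\Gamma^A(F,s,0)=\Gamma^A(F,s,a)$ for all $F,s$ and $a\in A$. Put $$Q(T,\Gamma,V)=\mathbb E\Big[\sum_{t=1}^T q_t\Big],\qquad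 \mathrm{Reg}(T,\Gamma,V)=\sup_{\pi\in\Pi}\mathbb E\Big[\sum_{t=1}^T \mathbf 1(a_t\ne a_t^m)-\sum_{t=1}^T\mathbf 1(\pi(s_t)\ne a_t^m)\Big].$$ **Smoothness.** For $\sigma\in(0,1]$, $V$ is $\sigma$-smooth if for every history $F$ the marginal $p$ of $V(F)$ on $S$ satisfies $p(X)\le\frac1\sigma\beta(X)$ for all $X\subseteq S$; every adversary is $0$-smooth. Put $\sigma^+=1/\sigma$ for $\sigma>0$ and $0^+=0$. **Realizability.** The pair $(\Gamma,V)$ is realizable if there is $\pi^*\in\Pi$ such that almost surely $\pi^*(s_t)=a_t^m$ for all $t\in\{1,\dots,T\}$. **Claim.** There is an absolute constant $C>0$ such that the following holds for all $S,A,\Pi,\beta,T$ as above, every integer $d\ge0$ and every $\sigma$. Assume that either (1) $\Pi$ has VC dimension $d$ and $\sigma\in(0,1]$, or (2) $\Pi$ has Littlestone dimension $d$ and $\sigma=0$. Then for every real $k\in(0,T]$ there is a query-agnostic algorithm $\Gamma_k$ such that for every $\sigma$-smooth adversary $V$ for which $(\Gamma_k,V)$ is realizable, $$Q(T,\Gamma_k,V)=k,\qquad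 \mathrm{Reg}(T,\Gamma_k,V)\le C\,\frac Tk\big(d\log(k+1)+\sigma^+\big),$$ and, if $k\ge2$, $$\mathrm{Reg}(T,\Gamma_k,V)\le C\,\frac Tk\big(d\log k+\sigma^+\big).$$ -/

import Mathlib

noncomputable section

namespace ActiveLearning

/-- What the agent and the adversary see of past rounds, in chronological order: the state, the
agent's action, and the query result. A query result is `some m` if the agent queried and the
correct action was `m`, and `none` (the dummy action) if the agent did not query. -/
abbrev History (S A : Type*) := List (S × A × Option A)

/-- An adversary maps a history to the joint distribution of the next state and the next correct
action. The state space will be countable, so `PMF` is the type of all probability distributions. -/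
abbrev Adversary (S A : Type*) := History S A → PMF (S × A)

/-- An active learning algorithm. -/
structure Algorithm (S A : Type*) where
  /-- the distribution of the query decision, given the history and the current state -/
  query : History S A → S → PMF Bool
  /-- the distribution of the action, given the history, the current state and the query result -/
  action : History S A → S → Option A → PMF A

/-- The action does not depend on the result of the query made in the same round. -/
def Algorithm.QueryAgnostic {S A : Type*} (Γ : Algorithm S A) : Prop :=
  ∀ (F : History S A) (s : S) (m : A), Γ.action F s none = Γ.action F s (some m)

/-- A full record of one round, including the correct action even if it was not observed. -/
structure Round (S A : Type*) where
  state : S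
  correct : A
  queried : Bool
  action : A

/-- The query result: the correct action if `q` is true, the dummy action otherwise. -/
def queryResult {A : Type*} (q : Bool) (m : A) : Option A := if q then some m else none

/-- The observable part of a round. -/
def Round.observed {S A : Type*} (r : Round S A) : S × A × Option A :=
  (r.state, r.action, queryResult r.queried r.correct)

/-- The distribution of the next round after history `F`: the adversary draws the state and the
correct action, then the algorithm draws its query decision, then its action. -/
def nextRound {S A : Type*} (Γ : Algorithm S A) (V : Adversary S A) (F : History S A) :
    PMF (Round S A) :=
  (V F).bind fun p =>
    (Γ.query F p.1).bind fun q =>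
      (Γ.action F p.1 (queryResult q p.2)).map fun a => ⟨p.1, p.2, q, a⟩

/-- The distribution of the full record (in chronological order) of the first `t` rounds. -/
def run {S A : Type*} (Γ : Algorithm S A) (V : Adversary S A) : ℕ → PMF (List (Round S A))
  | 0 => PMF.pure []
  | t + 1 => (run Γ V t).bind fun h =>
      (nextRound Γ V (h.map Round.observed)).map fun r => h ++ [r]

/-- The expectation of a real-valued function under a discrete distribution. It is only used for
functions that are bounded on the support of the distribution. -/
def expect {α : Type*} (p : PMF α) (f : α → ℝ) : ℝ := ∑' x, (p x).toReal * f x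

/-- The expected number of queries in `T` rounds. -/
def expectedQueries {S A : Type*} (T : ℕ) (Γ : Algorithm S A) (V : Adversary S A) : ℝ :=
  expect (run Γ V T) fun h => (h.map fun r => if r.queried then (1 : ℝ) else 0).sum

/-- The regret over `T` rounds with respect to the policy class `Pol` and the loss `l`, where
`l a m` is the loss of action `a` if the correct action is `m`. For losses in `[0, 1]` all the
expectations lie in `[-T, T]`, so the supremum is a genuine one as soon as `Pol` is nonempty. -/
def regret {S A : Type*} (Pol : Set (S → A)) (T : ℕ) (Γ : Algorithm S A) (V : Adversary S A)
    (l : A → A → ℝ) : ℝ :=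
  ⨆ π : Pol, expect (run Γ V T) fun h =>
    (h.map fun r => l r.action r.correct).sum - (h.map fun r => l (π.1 r.state) r.correct).sum

open Classical in
/-- The binary loss. -/
def binaryLoss {A : Type*} (a m : A) : ℝ := if a ≠ m then 1 else 0

/-- Some policy of the class almost surely agrees with the correct action in all `T` rounds. -/
def Realizable {S A : Type*} (Pol : Set (S → A)) (T : ℕ) (Γ : Algorithm S A)
    (V : Adversary S A) : Prop :=
  ∃ π ∈ Pol, ∀ h ∈ (run Γ V T).support, ∀ r ∈ h, π r.state = r.correct

/-- `p` is `σ`-smooth with respect to `β`: `p(X) ≤ β(X) / σ` for every set `X` of states; every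
distribution is `0`-smooth. -/
def IsSmooth {S : Type*} (β : PMF S) (σ : ℝ) (p : PMF S) : Prop :=
  0 < σ → ∀ X : Set S, p.toOuterMeasure X ≤ ENNReal.ofReal (1 / σ) * β.toOuterMeasure X

/-- An adversary is `σ`-smooth if after every history the next state has a `σ`-smooth
distribution. -/
def Adversary.IsSmooth {S A : Type*} (β : PMF S) (σ : ℝ) (V : Adversary S A) : Prop :=
  ∀ F : History S A, ActiveLearning.IsSmooth β σ ((V F).map Prod.fst)

/-- A finite set `X` of states is shattered if every labelling of `X` by actions is realized by a
policy of the class. (Used with two actions.) -/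
def Shatters {S A : Type*} (Pol : Set (S → A)) (X : Finset S) : Prop :=
  ∀ g : S → A, ∃ π ∈ Pol, ∀ x ∈ X, π x = g x

/-- The VC dimension: the supremum of the sizes of the shattered sets. -/
def vcDim {S A : Type*} (Pol : Set (S → A)) : ℕ∞ :=
  ⨆ (X : Finset S) (_ : Shatters Pol X), (X.card : ℕ∞)

/-- The class shatters some complete tree of depth `n` whose inner nodes are labelled by states
and whose edges below each node are labelled by the actions (with two actions: a binary mistake
tree), i.e. every branch is realized by a policy of the class. Depth `n + 1`: a root `s` and, for
each action `a`, a subtree of depth `n` shattered by the policies with `π s = a`. -/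
def ShattersTree {S A : Type*} : ℕ → Set (S → A) → Prop
  | 0, Pol => Pol.Nonempty
  | n + 1, Pol => ∃ s : S, ∀ a : A, ShattersTree n {π ∈ Pol | π s = a}

/-- The Littlestone dimension: the supremum of the depths of the shattered trees. -/
def littlestoneDim {S A : Type*} (Pol : Set (S → A)) : ℕ∞ :=
  ⨆ (n : ℕ) (_ : ShattersTree n Pol), (n : ℕ∞)

end ActiveLearning

end

/-! The algorithm tosses an independent coin of bias `p = k/T` in every round, whatever the state,
and acts by a deterministic rule on the past. The expected number of queries is then exactly `k`. A
query decision is independent of whether the round's action is wrong, so the expected number of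
queried mistakes is `p` times that of all mistakes (`meanTotal_queried`). Regret is thus at most
`T/k` times a bound on queried mistakes (`regret_fixedRate_le`), and only queried rounds need
analysis.

For Littlestone dimension `d`, the standard optimal algorithm on the version space makes at most `d`
queried mistakes. For VC dimension `d`, weighted majority runs on a `1/k`-cover `P` of the class
under `β`. Its queried mistakes number at most `4 log |P|` plus three times the queried errors of
the cover element near the true policy. By smoothness those errors have mean at most `T * p * (1/σ)
* (1/k) = 1/σ`, and `log |P| = O(d log k)` by a packing argument with Sauer-Shelah (`exists_cover`).
Where these bounds are vacuous, the trivial bound `T` suffices. -/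

/-! ### Expectations in `[0, ∞]` under discrete distributions. -/

namespace PMF

open scoped ENNReal

/-- The expectation of a function with values in `[0, ∞]` under a discrete distribution. -/
noncomputable def mean {α : Type*} (p : PMF α) (g : α → ℝ≥0∞) : ℝ≥0∞ := ∑' x, p x * g x

variable {α γ : Type*}

theorem mean_congr {p : PMF α} {g g' : α → ℝ≥0∞} (h : ∀ x ∈ p.support, g x = g' x) :
    p.mean g = p.mean g' := by
  refine tsum_congr fun x => ?_
  by_cases hx : p x = 0
  · simp [hx]
  · rw [h x ((p.mem_support_iff x).2 hx)]

theorem mean_mono {p : PMF α} {g g' : α → ℝ≥0∞} (h : ∀ x ∈ p.support, g x ≤ g' x) :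
    p.mean g ≤ p.mean g' := by
  refine ENNReal.tsum_le_tsum fun x => ?_
  by_cases hx : p x = 0
  · simp [hx]
  · exact mul_le_mul_right (h x ((p.mem_support_iff x).2 hx)) _

theorem mean_const (p : PMF α) (c : ℝ≥0∞) : p.mean (fun _ => c) = c := by
  simp [mean, ENNReal.tsum_mul_right, p.tsum_coe]

theorem mean_add (p : PMF α) (g g' : α → ℝ≥0∞) :
    p.mean (fun x => g x + g' x) = p.mean g + p.mean g' := by
  simp [mean, mul_add, ENNReal.tsum_add]

theorem mean_const_mul (p : PMF α) (c : ℝ≥0∞) (g : α → ℝ≥0∞) :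
    p.mean (fun x => c * g x) = c * p.mean g := by
  simp only [mean, ← ENNReal.tsum_mul_left]
  exact tsum_congr fun x => by ring

theorem mean_pure (a : α) (g : α → ℝ≥0∞) : (PMF.pure a).mean g = g a := by
  unfold mean
  rw [tsum_eq_single a fun b hb => by simp [PMF.pure_apply, hb]]
  simp

theorem mean_bind (p : PMF α) (f : α → PMF γ) (g : γ → ℝ≥0∞) :
    (p.bind f).mean g = p.mean fun a => (f a).mean g := by
  simp only [mean, PMF.bind_apply, ← ENNReal.tsum_mul_right, ← ENNReal.tsum_mul_left]
  rw [ENNReal.tsum_comm]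
  exact tsum_congr fun a => tsum_congr fun b => by ring

theorem mean_map (p : PMF α) (f : α → γ) (g : γ → ℝ≥0∞) :
    (p.map f).mean g = p.mean fun a => g (f a) := by
  rw [PMF.map, mean_bind]
  simp [mean_pure]

theorem mean_indicator (p : PMF α) (X : Set α) :
    p.mean (X.indicator 1) = p.toOuterMeasure X := by
  rw [mean, PMF.toOuterMeasure_apply]
  refine tsum_congr fun x => ?_
  by_cases hx : x ∈ X <;> simp [hx]

/-- The distribution of a coin that shows `true` with probability `p`. -/
noncomputable def coin (p : NNReal) (hp : p ≤ 1) : PMF Bool :=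
  PMF.ofFintype (fun b => cond b (p : ℝ≥0∞) ((1 - p : NNReal) : ℝ≥0∞)) (by
    rw [Fintype.sum_bool]
    simp only [cond_true, cond_false]
    rw [← ENNReal.coe_add, add_tsub_cancel_of_le hp, ENNReal.coe_one])

theorem mean_coin (p : NNReal) (hp : p ≤ 1) (g : Bool → ℝ≥0∞) :
    (coin p hp).mean g = p * g true + ((1 - p : NNReal) : ℝ≥0∞) * g false := by
  simp [mean, tsum_fintype, coin, PMF.ofFintype_apply]

end PMF

/-! ### Querying at a fixed rate: from regret to queried mistakes. -/

namespace ActiveLearning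

open scoped ENNReal

variable {S A : Type*}

/-- The sum of a cost over all rounds of a record. -/
def total (c : Round S A → ℕ) (h : List (Round S A)) : ℕ := (h.map c).sum

@[simp] theorem total_nil (c : Round S A → ℕ) : total c [] = 0 := rfl

@[simp] theorem total_append_singleton (c : Round S A → ℕ) (h : List (Round S A))
    (r : Round S A) : total c (h ++ [r]) = total c h + c r := by
  simp [total]

theorem total_le_length {c : Round S A → ℕ} (hc : ∀ r, c r ≤ 1) (h : List (Round S A)) :
    total c h ≤ h.length := by
  simpa [total] using List.sum_le_card_nsmul (h.map c) 1 (by simpa using fun r _ => hc r)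

theorem total_le_total {c c' : Round S A → ℕ} {h : List (Round S A)}
    (hc : ∀ r ∈ h, c r ≤ c' r) : total c h ≤ total c' h :=
  List.sum_le_sum hc

/-- The expected total cost of `t` rounds. -/
noncomputable def meanTotal (Γ : Algorithm S A) (V : Adversary S A) (t : ℕ) (c : Round S A → ℕ) : ℝ≥0∞ :=
  (run Γ V t).mean fun h => (total c h : ℝ≥0∞)

theorem meanTotal_zero (Γ : Algorithm S A) (V : Adversary S A) (c : Round S A → ℕ) :
    meanTotal Γ V 0 c = 0 := by
  simp [meanTotal, run, PMF.mean_pure]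

theorem meanTotal_succ (Γ : Algorithm S A) (V : Adversary S A) (t : ℕ) (c : Round S A → ℕ) :
    meanTotal Γ V (t + 1) c = meanTotal Γ V t c +
      (run Γ V t).mean fun h => (nextRound Γ V (h.map Round.observed)).mean
        fun r => (c r : ℝ≥0∞) := by
  simp only [meanTotal, run, PMF.mean_bind, PMF.mean_map, total_append_singleton, Nat.cast_add,
    PMF.mean_add, PMF.mean_const]

theorem length_of_mem_support_run {Γ : Algorithm S A} {V : Adversary S A} {t : ℕ}
    {h : List (Round S A)} (hh : h ∈ (run Γ V t).support) : h.length = t := by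
  induction t generalizing h with
  | zero => simp_all [run]
  | succ t ih =>
    simp only [run, PMF.mem_support_bind_iff, PMF.support_map, Set.mem_image] at hh
    obtain ⟨h', hh', r, -, rfl⟩ := hh
    simp [ih hh']

theorem meanTotal_le_of_forall {Γ : Algorithm S A} {V : Adversary S A} {c : Round S A → ℕ}
    {b : ℝ≥0∞} (hb : ∀ F, (nextRound Γ V F).mean (fun r => (c r : ℝ≥0∞)) ≤ b) (t : ℕ) :
    meanTotal Γ V t c ≤ t * b := by
  induction t with
  | zero => simp [meanTotal_zero]
  | succ t ih =>
    rw [meanTotal_succ, Nat.cast_succ, add_mul, one_mul]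
    refine add_le_add ih ((PMF.mean_mono fun h _ => hb _).trans_eq (PMF.mean_const _ _))

theorem meanTotal_le {Γ : Algorithm S A} {V : Adversary S A} {t : ℕ} {c : Round S A → ℕ}
    (hc : ∀ r, c r ≤ 1) : meanTotal Γ V t c ≤ t :=
  (PMF.mean_mono fun h hh => by
    exact_mod_cast (total_le_length hc h).trans_eq (length_of_mem_support_run hh)).trans_eq
      (PMF.mean_const _ _)

/-- The algorithm that queries with probability `p` in every round and acts according to a
deterministic rule. -/
noncomputable def fixedRate (f : History S A → S → A) (p : NNReal) (hp : p ≤ 1) : Algorithm S A where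
  query _ _ := PMF.coin p hp
  action F s _ := PMF.pure (f F s)

theorem fixedRate_queryAgnostic (f : History S A → S → A) (p : NNReal) (hp : p ≤ 1) :
    (fixedRate f p hp).QueryAgnostic := fun _ _ _ => rfl

section FixedRate

variable {f : History S A → S → A} {p : NNReal} {hp : p ≤ 1} {V : Adversary S A}

theorem mean_nextRound_fixedRate (F : History S A) (g : Round S A → ℝ≥0∞) :
    (nextRound (fixedRate f p hp) V F).mean g = (V F).mean fun x =>
      p * g ⟨x.1, x.2, true, f F x.1⟩ +
        ((1 - p : NNReal) : ℝ≥0∞) * g ⟨x.1, x.2, false, f F x.1⟩ := by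
  simp [nextRound, fixedRate, PMF.mean_bind, PMF.mean_map, PMF.mean_coin, PMF.mean_pure]

/-- A cost that does not depend on the query decision is charged in queried rounds only a
fraction `p` of the time. -/
theorem meanTotal_queried (c : S → A → A → ℕ) (t : ℕ) :
    meanTotal (fixedRate f p hp) V t
        (fun r => if r.queried then c r.state r.correct r.action else 0) =
      p * meanTotal (fixedRate f p hp) V t (fun r => c r.state r.correct r.action) := by
  induction t with
  | zero => simp [meanTotal_zero]
  | succ t ih =>
    rw [meanTotal_succ, meanTotal_succ, ih, mul_add, ← PMF.mean_const_mul]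
    congr 2
    funext h
    rw [mean_nextRound_fixedRate, mean_nextRound_fixedRate, ← PMF.mean_const_mul]
    congr 1
    funext x
    simp only [if_true, Bool.false_eq_true, if_false, Nat.cast_zero, mul_zero, add_zero]
    rw [← add_mul, ← ENNReal.coe_add, add_tsub_cancel_of_le hp, ENNReal.coe_one, one_mul]

theorem expect_natCast {α : Type*} (q : PMF α) (g : α → ℕ) :
    expect q (fun x => (g x : ℝ)) = (q.mean fun x => (g x : ℝ≥0∞)).toReal := by
  rw [PMF.mean, ENNReal.tsum_toReal_eq fun x =>
    ENNReal.mul_ne_top (PMF.apply_ne_top q x) (ENNReal.natCast_ne_top _)]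
  simp [expect]

theorem expect_le_mean {α : Type*} {q : PMF α} {u : α → ℝ} {g : α → ℕ}
    (hug : ∀ x, u x ≤ g x) (hg : q.mean (fun x => (g x : ℝ≥0∞)) ≠ ∞) :
    expect q u ≤ (q.mean fun x => (g x : ℝ≥0∞)).toReal := by
  rw [← expect_natCast]
  by_cases hu : Summable fun x => (q x).toReal * u x
  · refine hu.tsum_le_tsum (fun x => mul_le_mul_of_nonneg_left (hug x) ENNReal.toReal_nonneg) ?_
    simpa using ENNReal.summable_toReal hg
  -- Without summability the real `tsum` is 0 by convention, still below the nonnegative right side.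
  · rw [expect, tsum_eq_zero_of_not_summable hu]
    exact tsum_nonneg fun x => by positivity

open Classical in
/-- The number of mistakes in one round. -/
noncomputable def mistake (r : Round S A) : ℕ := if r.action ≠ r.correct then 1 else 0

open Classical in
/-- The number of mistakes in one round that the algorithm learns of. -/
noncomputable def queriedMistake (r : Round S A) : ℕ :=
  if r.queried then if r.action ≠ r.correct then 1 else 0 else 0

theorem mistake_le_one (r : Round S A) : mistake r ≤ 1 := by
  unfold mistake; split_ifs <;> simp

/-- The comparator's loss is nonnegative and is dropped, which handles all policies in the supremum
at once. -/
theorem regret_le {Pol : Set (S → A)} (hPol : Pol.Nonempty) {T : ℕ} {Γ : Algorithm S A}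
    {V : Adversary S A} : regret Pol T Γ V binaryLoss ≤ (meanTotal Γ V T mistake).toReal := by
  have : Nonempty Pol := hPol.to_subtype
  refine ciSup_le fun π => expect_le_mean (fun h => ?_)
    ((meanTotal_le mistake_le_one).trans_lt (ENNReal.natCast_lt_top _)).ne
  have h1 : (h.map fun r => binaryLoss r.action r.correct).sum = (total mistake h : ℝ) := by
    rw [total, Nat.cast_list_sum, List.map_map]
    congr 2
    funext r
    simp [binaryLoss, mistake]
  have h2 : 0 ≤ (h.map fun r => binaryLoss (π.1 r.state) r.correct).sum :=
    List.sum_nonneg fun x hx => by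
      obtain ⟨r, -, rfl⟩ := List.mem_map.1 hx
      unfold binaryLoss
      split_ifs <;> simp
  linarith

theorem regret_le_horizon {Pol : Set (S → A)} (hPol : Pol.Nonempty) {T : ℕ} {Γ : Algorithm S A}
    {V : Adversary S A} : regret Pol T Γ V binaryLoss ≤ T := by
  refine (regret_le hPol).trans ?_
  simpa using ENNReal.toReal_mono (ENNReal.natCast_ne_top T)
    (meanTotal_le (Γ := Γ) (V := V) (t := T) mistake_le_one)

theorem expectedQueries_fixedRate (T : ℕ) :
    expectedQueries T (fixedRate f p hp) V = p * T := by
  -- Charging the constant cost 1 in queried rounds counts the queries.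
  have h0 := meanTotal_queried (f := f) (p := p) (hp := hp) (V := V) (fun _ _ _ => 1) T
  have h1 : meanTotal (fixedRate f p hp) V T (fun _ => 1) = T := by
    rw [meanTotal, PMF.mean_congr (g' := fun _ => (T : ℝ≥0∞)), PMF.mean_const]
    intro h hh
    simp [total, length_of_mem_support_run hh]
  rw [h1] at h0
  have h2 : (fun h : List (Round S A) => (h.map fun r => if r.queried then (1 : ℝ) else 0).sum) =
      fun h => ((total (fun r => if r.queried then 1 else 0) h : ℕ) : ℝ) := by
    funext h
    rw [total, Nat.cast_list_sum, List.map_map]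
    congr 2
    funext r
    simp
  rw [expectedQueries, h2, expect_natCast, ← meanTotal, h0]
  simp

theorem regret_fixedRate_le {Pol : Set (S → A)} (hPol : Pol.Nonempty) {T : ℕ} (hp0 : 0 < p)
    {B : ℝ} (hB0 : 0 ≤ B)
    (hB : meanTotal (fixedRate f p hp) V T queriedMistake ≤ ENNReal.ofReal B) :
    regret Pol T (fixedRate f p hp) V binaryLoss ≤ B / p := by
  classical
  refine (regret_le hPol).trans ?_
  have h0 := meanTotal_queried (f := f) (p := p) (hp := hp) (V := V)
    (fun _ m a => if a ≠ m then 1 else 0) T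
  have h1 := ENNReal.toReal_mono ENNReal.ofReal_ne_top hB
  rw [ENNReal.toReal_ofReal hB0] at h1
  have h2 : meanTotal (fixedRate f p hp) V T queriedMistake =
      p * meanTotal (fixedRate f p hp) V T mistake := by
    convert h0 using 3
    · unfold queriedMistake; congr
    · unfold mistake; congr
  rw [h2, ENNReal.toReal_mul, ENNReal.coe_toReal] at h1
  rw [le_div_iff₀ (by exact_mod_cast hp0)]
  linarith

/-- The action rule was followed throughout the record. -/
def Follows (f : History S A → S → A) (h : List (Round S A)) : Prop :=
  ∀ h' r, h' ++ [r] <+: h → r.action = f (h'.map Round.observed) r.state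

theorem Follows.of_append {h : List (Round S A)} {r : Round S A} (hh : Follows f (h ++ [r])) :
    Follows f h := fun h' r' hr => hh h' r' (hr.trans (List.prefix_append _ _))

theorem Follows.last {h : List (Round S A)} {r : Round S A} (hh : Follows f (h ++ [r])) :
    r.action = f (h.map Round.observed) r.state := hh h r (List.prefix_refl _)

theorem follows_of_mem_support {t : ℕ} {h : List (Round S A)}
    (hh : h ∈ (run (fixedRate f p hp) V t).support) : Follows f h := by
  induction t generalizing h with
  | zero =>
    simp only [run, PMF.support_pure, Set.mem_singleton_iff] at hh
    subst hh
    intro h' r hr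
    simp at hr
  | succ t ih =>
    simp only [run, PMF.mem_support_bind_iff, PMF.support_map, Set.mem_image] at hh
    obtain ⟨h₀, hh₀, r, hr, rfl⟩ := hh
    intro h' r' hr'
    rcases List.prefix_concat_iff.1 hr' with heq | hpre
    · obtain ⟨rfl, hrr⟩ := List.append_inj' heq rfl
      simp only [List.cons.injEq, and_true] at hrr
      subst hrr
      simp only [nextRound, fixedRate, PMF.mem_support_bind_iff, PMF.support_map, Set.mem_image,
        PMF.support_pure, Set.mem_singleton_iff] at hr
      obtain ⟨x, -, q, -, a, rfl, rfl⟩ := hr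
      rfl
    · exact ih hh₀ _ _ hpre

end FixedRate

end ActiveLearning

/-! ### Littlestone dimension: the standard optimal algorithm. -/

namespace ActiveLearning

section Littlestone

variable {S A : Type*}

theorem ShattersTree.mono {n : ℕ} {W W' : Set (S → A)} (h : ShattersTree n W) (hW : W ⊆ W') :
    ShattersTree n W' := by
  induction n generalizing W W' with
  | zero => exact Set.Nonempty.mono hW h
  | succ n ih =>
    obtain ⟨s, hs⟩ := h
    exact ⟨s, fun a => ih (hs a) fun π hπ => ⟨hW hπ.1, hπ.2⟩⟩

theorem not_shattersTree_of_littlestoneDim {Pol : Set (S → A)} {d : ℕ}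
    (h : littlestoneDim Pol = d) : ¬ ShattersTree (d + 1) Pol := fun hs => by
  have h1 : ((d + 1 : ℕ) : ℕ∞) ≤ littlestoneDim Pol :=
    le_iSup₂_of_le (f := fun (n : ℕ) (_ : ShattersTree n Pol) => (n : ℕ∞)) (d + 1) hs le_rfl
  rw [h, Nat.cast_le] at h1
  omega

/-- The policies that are consistent with all query results. -/
def versionSpace (Pol : Set (S → A)) (F : History S A) : Set (S → A) :=
  {π ∈ Pol | ∀ e ∈ F, ∀ m, e.2.2 = some m → π e.1 = m}

theorem versionSpace_append_subset (Pol : Set (S → A)) (F G : History S A) :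
    versionSpace Pol (F ++ G) ⊆ versionSpace Pol F :=
  fun _ hπ => ⟨hπ.1, fun e he => hπ.2 e (List.mem_append_left _ he)⟩

theorem mem_versionSpace {Pol : Set (S → A)} {h : List (Round S A)} {π : S → A} (hπ : π ∈ Pol)
    (hr : ∀ r ∈ h, π r.state = r.correct) : π ∈ versionSpace Pol (h.map Round.observed) := by
  refine ⟨hπ, fun e he m hm => ?_⟩
  obtain ⟨r, hrh, rfl⟩ := List.mem_map.1 he
  rw [show (Round.observed r).1 = r.state from rfl, hr r hrh]
  simp only [Round.observed, queryResult] at hm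
  split_ifs at hm
  simpa using hm

variable [Nonempty A]

/-- The prediction of the standard optimal algorithm: a mistake decreases the Littlestone
dimension of the version space. -/
noncomputable def standardOptimal (Pol : Set (S → A)) (F : History S A) (s : S) : A :=
  Classical.epsilon fun a => ∀ m ≠ a,
    -- The `sInf` is the Littlestone dimension of the version space if that space is nonempty and
    -- the dimension finite; otherwise it is 0.
    ¬ ShattersTree (sInf {n | ¬ ShattersTree (n + 1) (versionSpace Pol F)})
      {π ∈ versionSpace Pol F | π s = m}

/-- If both labels of `s` left classes shattering trees of depth `sInf N`, then `s` as a root would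
give depth `sInf N + 1`. So one label fails, and with two actions predicting the other one is safe.
-/
theorem standardOptimal_spec (hA : Nat.card A = 2) {Pol : Set (S → A)} {F : History S A} {n : ℕ}
    (hn : ¬ ShattersTree (n + 1) (versionSpace Pol F)) (s : S) {m : A}
    (hm : m ≠ standardOptimal Pol F s) :
    ∃ n' ≤ n, ¬ ShattersTree n' {π ∈ versionSpace Pol F | π s = m} := by
  set N := {n | ¬ ShattersTree (n + 1) (versionSpace Pol F)} with hN
  have hmem : ¬ ShattersTree (sInf N + 1) (versionSpace Pol F) := Nat.sInf_mem (s := N) ⟨n, hn⟩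
  have hex : ∃ a, ∀ m ≠ a, ¬ ShattersTree (sInf N) {π ∈ versionSpace Pol F | π s = m} := by
    simp only [ShattersTree, not_exists, not_forall] at hmem
    obtain ⟨b, hb⟩ := hmem s
    obtain ⟨x, y, -, hxy⟩ := Nat.card_eq_two_iff.1 hA
    have hall : ∀ z : A, z = x ∨ z = y := fun z => by
      simpa using (hxy ▸ Set.mem_univ z : z ∈ ({x, y} : Set A))
    rcases hall b with rfl | rfl
    · exact ⟨y, fun m hm => ((hall m).resolve_right hm) ▸ hb⟩
    · exact ⟨x, fun m hm => ((hall m).resolve_left hm) ▸ hb⟩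
  exact ⟨sInf N, Nat.sInf_le hn, Classical.epsilon_spec hex m hm⟩

/-- Potential argument: `n` bounds the dimension of the version space, and each queried mistake
lowers it by at least one. -/
theorem exists_not_shattersTree_versionSpace (hA : Nat.card A = 2) {Pol : Set (S → A)} {d : ℕ}
    (hd : ¬ ShattersTree (d + 1) Pol) {π : S → A} (hπ : π ∈ Pol) {h : List (Round S A)}
    (hf : Follows (standardOptimal Pol) h) (hr : ∀ r ∈ h, π r.state = r.correct) :
    ∃ n, n + total queriedMistake h ≤ d ∧
      ¬ ShattersTree (n + 1) (versionSpace Pol (h.map Round.observed)) := by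
  induction h using List.reverseRecOn with
  | nil => exact ⟨d, by simp, fun hs => hd (hs.mono fun _ hπ => hπ.1)⟩
  | append_singleton h r ih =>
    obtain ⟨n, hn, hns⟩ := ih hf.of_append fun r' hr' => hr r' (List.mem_append_left _ hr')
    have hact := hf.last
    by_cases hq : r.queried = true ∧ r.action ≠ r.correct
    · obtain ⟨n', hn', hs'⟩ := standardOptimal_spec hA hns r.state (m := r.correct)
        (by rw [← hact]; exact hq.2.symm)
      have hsub : versionSpace Pol ((h ++ [r]).map Round.observed) ⊆
          {π ∈ versionSpace Pol (h.map Round.observed) | π r.state = r.correct} := by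
        intro π' hπ'
        rw [List.map_append] at hπ'
        refine ⟨versionSpace_append_subset _ _ _ hπ', ?_⟩
        refine hπ'.2 (Round.observed r) (by simp) r.correct ?_
        simp [Round.observed, queryResult, hq.1]
      have hs := fun hs => hs' (ShattersTree.mono hs hsub)
      have hmem := mem_versionSpace hπ hr
      -- The true policy is never eliminated, so a tree of depth 0 is always shattered.
      have hpos : n' ≠ 0 := by
        rintro rfl
        exact hs ⟨π, hmem⟩
      obtain ⟨j, rfl⟩ := Nat.exists_eq_succ_of_ne_zero hpos
      refine ⟨j, ?_, hs⟩
      have : queriedMistake r = 1 := by simp [queriedMistake, hq]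
      rw [total_append_singleton, this]
      omega
    · refine ⟨n, ?_, fun hs => hns (hs.mono ?_)⟩
      · have : queriedMistake r = 0 := by
          unfold queriedMistake
          split_ifs <;> simp_all
        rw [total_append_singleton, this]
        omega
      · rw [List.map_append]
        exact versionSpace_append_subset _ _ _

/-- The standard optimal algorithm learns of at most `d` mistakes if the Littlestone dimension
is `d`. -/
theorem meanTotal_queriedMistake_standardOptimal (hA : Nat.card A = 2) {Pol : Set (S → A)}
    {d : ℕ} (hd : littlestoneDim Pol = d) {T : ℕ} {p : NNReal} {hp : p ≤ 1} {V : Adversary S A}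
    (hreal : Realizable Pol T (fixedRate (standardOptimal Pol) p hp) V) :
    meanTotal (fixedRate (standardOptimal Pol) p hp) V T queriedMistake ≤ d := by
  obtain ⟨π, hπ, hr⟩ := hreal
  refine (PMF.mean_mono fun h hh => ?_).trans_eq (PMF.mean_const _ _)
  obtain ⟨n, hn, -⟩ := exists_not_shattersTree_versionSpace hA
    (not_shattersTree_of_littlestoneDim hd) hπ (follows_of_mem_support hh) (hr h hh)
  exact_mod_cast (Nat.le_add_left _ n).trans hn

end Littlestone

end ActiveLearning

/-! ### Weighted majority over a finite set of policies. -/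

namespace ActiveLearning

section WeightedMajority

open scoped ENNReal

variable {S A : Type*}

open Classical in
/-- The number of errors of a policy that the history reveals. -/
noncomputable def revealedErrors (π : S → A) (F : History S A) : ℕ :=
  F.countP fun e => ∃ m, e.2.2 = some m ∧ π e.1 ≠ m

open Classical in
/-- The number of revealed errors of a policy in one round. -/
noncomputable def queriedError (π : S → A) (r : Round S A) : ℕ :=
  if r.queried ∧ π r.state ≠ r.correct then 1 else 0

theorem revealedErrors_append (π : S → A) (F G : History S A) :
    revealedErrors π (F ++ G) = revealedErrors π F + revealedErrors π G :=
  List.countP_append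

theorem revealedErrors_singleton (π : S → A) (r : Round S A) :
    revealedErrors π [r.observed] = queriedError π r := by
  rcases r with ⟨s, m, q, a⟩
  by_cases h : π s = m <;> cases q <;>
    simp [revealedErrors, queriedError, Round.observed, queryResult, h]

theorem revealedErrors_map_observed (π : S → A) (h : List (Round S A)) :
    revealedErrors π (h.map Round.observed) = total (queriedError π) h := by
  induction h using List.reverseRecOn with
  | nil => simp [revealedErrors]
  | append_singleton h r ih =>
    rw [List.map_append, revealedErrors_append, ih, total_append_singleton, List.map_singleton,
      revealedErrors_singleton]

/-- The weight of a policy is halved by every revealed error. -/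
noncomputable def weight (F : History S A) (π : S → A) : ℝ := (1 / 2) ^ revealedErrors π F

theorem weight_pos (F : History S A) (π : S → A) : 0 < weight F π := by
  unfold weight; positivity

open Classical in
/-- The total weight of the policies that vote for the action `a`. -/
noncomputable def vote (P : Finset (S → A)) (F : History S A) (s : S) (a : A) : ℝ :=
  ∑ π ∈ P with π s = a, weight F π

-- Both policies are fixed before the run, so smoothness bounds the chance of disagreement by `ε/σ`
-- after every history, however adaptive the adversary is.
open Classical in
theorem meanTotal_disagreement_le {f : History S A → S → A} {p : NNReal} {hp : p ≤ 1}
    {V : Adversary S A} {β : PMF S} {σ ε : ℝ} (hσ : 0 < σ) (hV : V.IsSmooth β σ)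
    {π π' : S → A} (hε : β.toOuterMeasure {s | π s ≠ π' s} ≤ ENNReal.ofReal ε) (T : ℕ) :
    meanTotal (fixedRate f p hp) V T
        (fun r => if r.queried then if π r.state ≠ π' r.state then 1 else 0 else 0) ≤
      T * (p * (ENNReal.ofReal (1 / σ) * ENNReal.ofReal ε)) := by
  refine meanTotal_le_of_forall (fun F => ?_) T
  rw [mean_nextRound_fixedRate]
  have h1 := (hV F hσ {s | π s ≠ π' s}).trans (mul_le_mul_right hε _)
  rw [← PMF.mean_indicator, PMF.mean_map] at h1
  refine le_trans ?_ (mul_le_mul_right h1 _)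
  rw [← PMF.mean_const_mul]
  refine PMF.mean_mono fun x _ => ?_
  by_cases hx : π x.1 = π' x.1 <;> simp [hx]

variable [Nonempty A]

/-- The action that gets the largest weight. -/
noncomputable def weightedMajority (P : Finset (S → A)) (F : History S A) (s : S) : A :=
  Classical.epsilon fun a => ∀ b, vote P F s b ≤ vote P F s a

theorem vote_le_vote_weightedMajority [Finite A] (P : Finset (S → A)) (F : History S A) (s : S)
    (b : A) : vote P F s b ≤ vote P F s (weightedMajority P F s) :=
  Classical.epsilon_spec (Finite.exists_max (vote P F s)) b

/-- On a queried mistake the correct action had at most as much weight as the chosen one, so at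
least half of the weight was wrong and is halved: a factor of at most `3/4`. In other rounds the
weight cannot grow. -/
theorem sum_weight_le [Finite A] (P : Finset (S → A)) {h : List (Round S A)}
    (hf : Follows (weightedMajority P) h) :
    ∑ π ∈ P, weight (h.map Round.observed) π ≤ P.card * (3 / 4) ^ total queriedMistake h := by
  classical
  induction h using List.reverseRecOn with
  | nil => simp [weight, revealedErrors]
  | append_singleton h r ih =>
    specialize ih hf.of_append
    set F := h.map Round.observed with hF
    have hw : ∀ π, weight ((h ++ [r]).map Round.observed) π =
        weight F π * (1 / 2) ^ queriedError π r := fun π => by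
      rw [List.map_append, List.map_singleton, weight, revealedErrors_append,
        revealedErrors_singleton, pow_add, weight]
    simp only [hw, total_append_singleton]
    by_cases hq : r.queried = true ∧ r.action ≠ r.correct
    · have hm : queriedMistake r = 1 := by simp [queriedMistake, hq]
      have hvote := vote_le_vote_weightedMajority P F r.state r.correct
      rw [← hf.last] at hvote
      have hle : vote P F r.state r.action ≤ ∑ π ∈ P with ¬ π r.state = r.correct, weight F π := by
        refine Finset.sum_le_sum_of_subset_of_nonneg (fun π hπ => ?_)
          fun π _ _ => (weight_pos F π).le
        rw [Finset.mem_filter] at hπ ⊢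
        exact ⟨hπ.1, fun h => hq.2 (hπ.2.symm.trans h)⟩
      have hsplit := Finset.sum_filter_add_sum_filter_not P (fun π => π r.state = r.correct)
        (weight F)
      have hnew : ∑ π ∈ P, weight F π * (1 / 2) ^ queriedError π r =
          vote P F r.state r.correct +
            1 / 2 * ∑ π ∈ P with ¬ π r.state = r.correct, weight F π := by
        rw [← Finset.sum_filter_add_sum_filter_not P (fun π => π r.state = r.correct), vote,
          Finset.mul_sum]
        congr 1
        · refine Finset.sum_congr rfl fun π hπ => ?_
          simp [queriedError, (Finset.mem_filter.1 hπ).2]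
        · refine Finset.sum_congr rfl fun π hπ => ?_
          have : queriedError π r = 1 := by simp [queriedError, (Finset.mem_filter.1 hπ).2, hq.1]
          rw [this]; ring
      rw [hnew, hm, pow_add, pow_one]
      simp only [vote] at *
      linarith
    · have hm : queriedMistake r = 0 := by
        unfold queriedMistake
        split_ifs <;> simp_all
      rw [hm, add_zero]
      refine (Finset.sum_le_sum fun π _ => ?_).trans ih
      exact mul_le_of_le_one_right (weight_pos F π).le (pow_le_one₀ (by norm_num) (by norm_num))

/-- The mistake bound of the weighted majority algorithm. -/
theorem total_queriedMistake_weightedMajority_le [Finite A] {P : Finset (S → A)} {π : S → A}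
    (hπ : π ∈ P) {h : List (Round S A)} (hf : Follows (weightedMajority P) h) :
    (total queriedMistake h : ℝ) ≤ 4 * Real.log P.card + 3 * total (queriedError π) h := by
  have h1 : weight (h.map Round.observed) π ≤ ∑ π ∈ P, weight (h.map Round.observed) π :=
    Finset.single_le_sum (fun π _ => (weight_pos _ π).le) hπ
  have h2 := h1.trans (sum_weight_le P hf)
  rw [weight, revealedErrors_map_observed] at h2
  have hP : (0 : ℝ) < P.card := by exact_mod_cast Finset.card_pos.2 ⟨π, hπ⟩
  have h3 := Real.log_le_log (by positivity) h2
  rw [Real.log_mul hP.ne' (by positivity), Real.log_pow, Real.log_pow, one_div, Real.log_inv] at h3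
  -- With `M` mistakes and `E` errors of `π`, `h3` reads `-E log 2 ≤ log |P| + M log (3/4)`. The two
  -- numerical bounds turn it into `M ≤ 4 log |P| + 3 E`.
  have h4 : Real.log (3 / 4) ≤ -(1 / 4) := by
    have := Real.log_le_sub_one_of_pos (show (0 : ℝ) < 3 / 4 by norm_num)
    linarith
  have h5 : Real.log 2 ≤ 3 / 4 := by linarith [Real.log_two_lt_d9]
  have h6 := mul_le_mul_of_nonneg_left h4 (Nat.cast_nonneg (α := ℝ) (total queriedMistake h))
  have h7 := mul_le_mul_of_nonneg_left h5 (Nat.cast_nonneg (α := ℝ) (total (queriedError π) h))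
  linarith

/-- Realizability provides one true policy for all records, hence one nearby element of `P`. The
errors of that element are its disagreements with the true policy. -/
theorem meanTotal_queriedMistake_weightedMajority [Finite A] {Pol : Set (S → A)}
    {P : Finset (S → A)} {T : ℕ} {p : NNReal} {hp : p ≤ 1} {V : Adversary S A}
    {β : PMF S} {σ ε : ℝ} (hσ : 0 < σ) (hε : 0 ≤ ε) (hV : V.IsSmooth β σ)
    (hP : ∀ π ∈ Pol, ∃ π' ∈ P, β.toOuterMeasure {s | π s ≠ π' s} ≤ ENNReal.ofReal ε)
    (hreal : Realizable Pol T (fixedRate (weightedMajority P) p hp) V) :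
    meanTotal (fixedRate (weightedMajority P) p hp) V T queriedMistake ≤
      ENNReal.ofReal (4 * Real.log P.card + 3 * (T * (p * (1 / σ * ε)))) := by
  classical
  obtain ⟨π, hπ, hr⟩ := hreal
  obtain ⟨π', hπ', hd⟩ := hP π hπ
  have hlog : 0 ≤ Real.log P.card := Real.log_natCast_nonneg _
  have h1 := meanTotal_disagreement_le (f := weightedMajority P) (p := p) (hp := hp) hσ hV hd T
  calc meanTotal (fixedRate (weightedMajority P) p hp) V T queriedMistake
      ≤ ENNReal.ofReal (4 * Real.log P.card) +
          3 * meanTotal (fixedRate (weightedMajority P) p hp) V T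
            (fun r => if r.queried then if π r.state ≠ π' r.state then 1 else 0 else 0) := by
        rw [meanTotal, meanTotal, ← PMF.mean_const_mul,
          ← PMF.mean_const (run _ V T) (ENNReal.ofReal _), ← PMF.mean_add]
        refine PMF.mean_mono fun h hh => ?_
        have h2 := total_queriedMistake_weightedMajority_le hπ' (follows_of_mem_support hh)
        have h3 : total (queriedError π') h ≤ total (fun r => if r.queried then
            if π r.state ≠ π' r.state then 1 else 0 else 0) h := by
          refine total_le_total fun r hrh => ?_
          have := hr h hh r hrh
          unfold queriedError
          split_ifs <;> simp_all
        have h4 : (total queriedMistake h : ℝ) ≤ 4 * Real.log P.card + ((3 * total (fun r =>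
            if r.queried then if π r.state ≠ π' r.state then 1 else 0 else 0) h : ℕ) : ℝ) := by
          push_cast
          have : (total (queriedError π') h : ℝ) ≤ _ := Nat.cast_le.2 h3
          linarith
        have h5 := ENNReal.ofReal_le_ofReal h4
        rw [ENNReal.ofReal_add (by positivity) (Nat.cast_nonneg _), ENNReal.ofReal_natCast,
          ENNReal.ofReal_natCast] at h5
        simpa using h5
    _ ≤ ENNReal.ofReal (4 * Real.log P.card) +
          3 * (T * (p * (ENNReal.ofReal (1 / σ) * ENNReal.ofReal ε))) := by gcongr
    _ = _ := by
        rw [ENNReal.ofReal_add (by positivity) (by positivity),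
          ENNReal.ofReal_mul (by norm_num : (0 : ℝ) ≤ 3), ENNReal.ofReal_mul (Nat.cast_nonneg T),
          ENNReal.ofReal_mul p.coe_nonneg, ENNReal.ofReal_mul (by positivity : 0 ≤ 1 / σ),
          ENNReal.ofReal_natCast, ENNReal.ofReal_coe_nnreal]
        simp

end WeightedMajority

end ActiveLearning

/-! ### Covers of classes of finite VC dimension. -/

namespace ActiveLearning

section Covering

open scoped ENNReal

variable {S A : Type*}

-- Under `s ∼ β` the expected number of pairs that `s` fails to separate is at most `q * |U|`; a
-- minimizing state does no worse than the average.
open Classical in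
theorem exists_card_filter_le (β : PMF S) (U : Finset ((S → A) × (S → A))) {q : ℝ≥0∞}
    (hU : ∀ x ∈ U, β.toOuterMeasure {s | x.1 s = x.2 s} ≤ q) :
    ∃ s, ((U.filter fun x => x.1 s = x.2 s).card : ℝ≥0∞) ≤ q * U.card := by
  have : Nonempty S := β.support_nonempty.to_type
  set g : S → ℕ := fun s => (U.filter fun x => x.1 s = x.2 s).card with hg
  obtain ⟨s₀, hs₀⟩ : ∃ s₀, ∀ s, g s₀ ≤ g s :=
    ⟨Function.argmin g, fun s => Function.argmin_le g s⟩
  refine ⟨s₀, ?_⟩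
  calc ((g s₀ : ℕ) : ℝ≥0∞) = β.mean fun _ => (g s₀ : ℝ≥0∞) := (PMF.mean_const _ _).symm
    _ ≤ β.mean fun s => (g s : ℝ≥0∞) := PMF.mean_mono fun s _ => Nat.cast_le.2 (hs₀ s)
    _ = ∑ x ∈ U, β.toOuterMeasure {s | x.1 s = x.2 s} := by
        simp only [← PMF.mean_indicator]
        simp only [PMF.mean]
        rw [← Summable.tsum_finsetSum fun _ _ => ENNReal.summable]
        refine tsum_congr fun s => ?_
        rw [← Finset.mul_sum, hg]
        congr 1
        simp [Set.indicator_apply]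
    _ ≤ ∑ _x ∈ U, q := Finset.sum_le_sum hU
    _ = q * U.card := by rw [Finset.sum_const, nsmul_eq_mul, mul_comm]

-- A greedy replacement for sampling `m` states from `β`: each new state is chosen for the pairs not
-- yet separated.
open Classical in
theorem exists_finset_card_filter_le (β : PMF S) (U : Finset ((S → A) × (S → A))) {q : ℝ≥0∞}
    (hU : ∀ x ∈ U, β.toOuterMeasure {s | x.1 s = x.2 s} ≤ q) (m : ℕ) :
    ∃ X : Finset S, X.card ≤ m ∧
      ((U.filter fun x => ∀ s ∈ X, x.1 s = x.2 s).card : ℝ≥0∞) ≤ q ^ m * U.card := by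
  induction m with
  | zero => exact ⟨∅, by simp, by simp⟩
  | succ m ih =>
    obtain ⟨X, hX, hXU⟩ := ih
    obtain ⟨s, hs⟩ := exists_card_filter_le β (U.filter fun x => ∀ s ∈ X, x.1 s = x.2 s)
      fun x hx => hU x (Finset.mem_filter.1 hx).1
    refine ⟨insert s X, (Finset.card_insert_le _ _).trans (by omega), ?_⟩
    have heq : (U.filter fun x => ∀ s' ∈ insert s X, x.1 s' = x.2 s') =
        (U.filter fun x => ∀ s ∈ X, x.1 s = x.2 s).filter fun x => x.1 s = x.2 s := by
      ext x
      simp only [Finset.mem_filter, Finset.mem_insert, forall_eq_or_imp]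
      tauto
    rw [heq]
    refine hs.trans ((mul_le_mul_right hXU q).trans_eq ?_)
    ring

theorem sum_choose_le_pow (m d : ℕ) : ∑ i ∈ Finset.range (d + 1), m.choose i ≤ (m + 1) ^ d := by
  rw [add_pow]
  refine Finset.sum_le_sum fun i hi => ?_
  rw [one_pow, mul_one]
  exact (Nat.choose_le_pow m i).trans
    (Nat.le_mul_of_pos_right _ (Nat.choose_pos (Nat.lt_succ_iff.1 (Finset.mem_range.1 hi))))

theorem card_le_of_shatters {Pol : Set (S → A)} {d : ℕ} (hd : vcDim Pol = d) {X : Finset S}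
    (hX : Shatters Pol X) : X.card ≤ d := by
  have h : (X.card : ℕ∞) ≤ vcDim Pol :=
    le_iSup₂_of_le (f := fun (X : Finset S) (_ : Shatters Pol X) => (X.card : ℕ∞)) X hX le_rfl
  rw [hd] at h
  exact_mod_cast h

/-- The Sauer-Shelah bound on the number of policies that are distinguished by a set of
states. -/
theorem card_le_of_separated (hA : Nat.card A = 2) {Pol : Set (S → A)} {d : ℕ}
    (hd : vcDim Pol = d) {P : Finset (S → A)} (hP : ↑P ⊆ Pol) {X : Finset S} {m : ℕ}
    (hXm : X.card ≤ m) (hX : ∀ π ∈ P, ∀ π' ∈ P, (∀ s ∈ X, π s = π' s) → π = π') :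
    P.card ≤ (m + 1) ^ d := by
  classical
  obtain ⟨a, b, hab, huniv⟩ := Nat.card_eq_two_iff.1 hA
  have hall : ∀ z : A, z = a ∨ z = b := fun z => by
    simpa using (huniv ▸ Set.mem_univ z : z ∈ ({a, b} : Set A))
  have heq : ∀ y z : A, (y = a ↔ z = a) → y = z := fun y z h => by
    rcases hall y with hy | hy <;> rcases hall z with hz | hz <;> simp_all
  -- Encoding a policy by the subset of `X` where it plays `a` makes the set-family form of
  -- Sauer-Shelah applicable.
  set R : (S → A) → Finset S := fun π => X.filter fun s => π s = a with hR
  have hinj : Set.InjOn R P := fun π hπ π' hπ' h => hX π hπ π' hπ' fun s hs => heq _ _ (by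
    have := Finset.ext_iff.1 h s
    simpa [hR, hs] using this)
  rw [← Finset.card_image_of_injOn hinj]
  refine (Finset.card_le_card_shatterer _).trans ?_
  have hsub : (P.image R).shatterer ⊆
      (Finset.range (d + 1)).biUnion fun i => X.powersetCard i := by
    intro Y hY
    rw [Finset.mem_shatterer] at hY
    rw [Finset.mem_biUnion]
    refine ⟨Y.card, Finset.mem_range.2 (Nat.lt_succ_iff.2 (card_le_of_shatters hd ?_)),
      Finset.mem_powersetCard.2 ⟨?_, rfl⟩⟩
    · intro g
      obtain ⟨u, hu, hYu⟩ := hY (Finset.filter_subset (fun s => g s = a) Y)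
      obtain ⟨π, hπ, rfl⟩ := Finset.mem_image.1 hu
      refine ⟨π, hP hπ, fun x hx => heq _ _ ?_⟩
      -- Some trace contains `Y`, and traces lie in `X`; hence `x ∈ X`.
      obtain ⟨u', hu', hYu'⟩ := hY.exists_superset
      obtain ⟨π', -, rfl⟩ := Finset.mem_image.1 hu'
      have hxX : x ∈ X := (Finset.mem_filter.1 (hYu' hx)).1
      have := Finset.ext_iff.1 hYu x
      simpa [hR, hx, hxX] using this
    · obtain ⟨u, hu, hYu⟩ := hY.exists_superset
      obtain ⟨π, -, rfl⟩ := Finset.mem_image.1 hu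
      exact hYu.trans (Finset.filter_subset _ _)
  calc _ ≤ _ := Finset.card_le_card hsub
    _ ≤ ∑ i ∈ Finset.range (d + 1), (X.powersetCard i).card := Finset.card_biUnion_le
    _ ≤ ∑ i ∈ Finset.range (d + 1), m.choose i := Finset.sum_le_sum fun i _ => by
        rw [Finset.card_powersetCard]
        exact Nat.choose_le_choose i hXm
    _ ≤ (m + 1) ^ d := sum_choose_le_pow m d

theorem toOuterMeasure_eq_add_ne (β : PMF S) (π π' : S → A) :
    β.toOuterMeasure {s | π s = π' s} + β.toOuterMeasure {s | π s ≠ π' s} = 1 := by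
  classical
  rw [← PMF.mean_indicator, ← PMF.mean_indicator, ← PMF.mean_add, ← PMF.mean_const β 1]
  congr 1
  funext s
  by_cases h : π s = π' s <;> simp [h]

/-- Solves the self-referential bound of the packing argument. With `L = d * y`, the assumption `d ≤
k` gives `y ≤ 4 log k + log (1 + y)`, and linearizing the logarithm at `y = 1` absorbs half of `y`
on the left. -/
theorem log_le_of_le_mul_log {L k : ℝ} {d : ℕ} (hL : 0 ≤ L) (hk : 2 ≤ k) (hdk : d ≤ k)
    (h : L ≤ d * Real.log (2 * k * L + 2)) : L ≤ 10 * (d * Real.log k) := by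
  rcases Nat.eq_zero_or_pos d with rfl | hd
  · simpa using h
  have hd' : (0 : ℝ) < d := by exact_mod_cast hd
  obtain ⟨y, rfl⟩ : ∃ y, L = d * y := ⟨L / d, by field_simp⟩
  have hy : 0 ≤ y := nonneg_of_mul_nonneg_right hL hd'
  have h1 : y ≤ Real.log (2 * k * (d * y) + 2) := le_of_mul_le_mul_left h hd'
  have h2 : 2 * k * (d * y) + 2 ≤ k ^ 4 * (1 + y) := by
    have e1 : 2 * k * (d * y) ≤ 2 * k * (k * y) := by gcongr
    have e2 : 2 * k ^ 2 ≤ k ^ 4 := by nlinarith [mul_self_nonneg (k ^ 2), pow_le_pow_left₀ (by norm_num) hk 2]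
    nlinarith
  have h3 := h1.trans (Real.log_le_log (by positivity) h2)
  rw [Real.log_mul (by positivity) (by positivity), Real.log_pow] at h3
  have h4 := Real.log_le_sub_one_of_pos (show 0 < (1 + y) / 2 by positivity)
  rw [Real.log_div (by positivity) (by norm_num)] at h4
  have h5 : Real.log 2 ≤ Real.log k := Real.log_le_log (by norm_num) hk
  have h6 := Real.log_two_gt_d9
  have h7 := Real.log_two_lt_d9
  push_cast at h3
  have h8 : y ≤ 10 * Real.log k := by linarith
  nlinarith

/-- Separated policies agree with probability at most `1 - 1/k`, so about `2k log |P|` states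
distinguish all pairs. Sauer-Shelah then bounds `|P|` by a power of `log |P|` itself. -/
theorem log_card_packing_le (hA : Nat.card A = 2) {Pol : Set (S → A)} {d : ℕ}
    (hd : vcDim Pol = d) (β : PMF S) {k : ℝ} (hk : 2 ≤ k) (hdk : d ≤ k) {P : Finset (S → A)}
    (hP : ↑P ⊆ Pol) (hsep : ∀ π ∈ P, ∀ π' ∈ P, π ≠ π' →
      ENNReal.ofReal (1 / k) < β.toOuterMeasure {s | π s ≠ π' s}) :
    Real.log P.card ≤ 10 * (d * Real.log k) := by
  classical
  rcases P.eq_empty_or_nonempty with rfl | hne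
  · simp only [Finset.card_empty, Nat.cast_zero, Real.log_zero]
    have := Real.log_nonneg (show 1 ≤ k by linarith)
    positivity
  have hN : (0 : ℝ) < P.card := by exact_mod_cast hne.card_pos
  set L := Real.log P.card with hL
  have hL0 : 0 ≤ L := Real.log_natCast_nonneg _
  have hk0 : 0 < k := by linarith
  have hk1 : 0 ≤ 1 - 1 / k := by
    rw [sub_nonneg, div_le_one hk0]; linarith
  -- Chosen so that `m > 2kL`, whence `exp (-m/k) < |P|⁻²` and fewer than one pair stays
  -- unseparated.
  set m := ⌊2 * k * L⌋₊ + 1 with hm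
  have hq : ∀ x ∈ P.offDiag,
      β.toOuterMeasure {s | x.1 s = x.2 s} ≤ ENNReal.ofReal (1 - 1 / k) := fun x hx => by
    obtain ⟨h1, h2, h3⟩ := Finset.mem_offDiag.1 hx
    have h4 := toOuterMeasure_eq_add_ne β x.1 x.2
    rw [ENNReal.ofReal_sub _ (by positivity), ENNReal.ofReal_one]
    refine ENNReal.le_sub_of_add_le_right ENNReal.ofReal_ne_top ?_
    rw [← h4]
    gcongr
    exact (hsep _ h1 _ h2 h3).le
  obtain ⟨X, hXm, hX⟩ := exists_finset_card_filter_le β P.offDiag hq m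
  have hlt : (1 - 1 / k) ^ m * P.offDiag.card < 1 := by
    have e1 : (1 - 1 / k) ^ m ≤ Real.exp (-(m / k)) := by
      calc (1 - 1 / k) ^ m ≤ Real.exp (-(1 / k)) ^ m := by
            gcongr
            exact Real.one_sub_le_exp_neg _
        _ = Real.exp (-(m / k)) := by
            rw [← Real.exp_nat_mul]
            congr 1
            ring
    have e2 : Real.exp (-(m / k)) < Real.exp (-(2 * L)) := by
      rw [Real.exp_lt_exp, neg_lt_neg_iff, lt_div_iff₀ hk0]
      have := Nat.lt_floor_add_one (2 * k * L)
      rw [hm]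
      push_cast
      linarith
    have e3 : (P.offDiag.card : ℝ) ≤ P.card * P.card := by
      rw [Finset.offDiag_card]
      exact_mod_cast Nat.sub_le _ _
    have e4 : Real.exp (-(2 * L)) * (P.card * P.card) = 1 := by
      rw [neg_mul_eq_mul_neg, two_mul, Real.exp_add, Real.exp_neg, hL, Real.exp_log hN]
      field_simp
    calc (1 - 1 / k) ^ m * P.offDiag.card ≤ (1 - 1 / k) ^ m * (P.card * P.card) := by gcongr
      _ < Real.exp (-(2 * L)) * (P.card * P.card) := by
          have := e1.trans_lt e2
          gcongr
      _ = 1 := e4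
  have hzero : (P.offDiag.filter fun x => ∀ s ∈ X, x.1 s = x.2 s).card = 0 := by
    have h1 : ENNReal.ofReal (1 - 1 / k) ^ m * P.offDiag.card < 1 := by
      rw [← ENNReal.ofReal_pow hk1, ← ENNReal.ofReal_natCast, ← ENNReal.ofReal_mul (by positivity),
        ENNReal.ofReal_lt_one]
      exact hlt
    exact Nat.lt_one_iff.1 (by exact_mod_cast hX.trans_lt h1)
  rw [Finset.card_eq_zero] at hzero
  have hcard := card_le_of_separated hA hd hP hXm fun π hπ π' hπ' h => by
    by_contra hne'
    have : (π, π') ∈ P.offDiag.filter fun x => ∀ s ∈ X, x.1 s = x.2 s :=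
      Finset.mem_filter.2 ⟨Finset.mem_offDiag.2 ⟨hπ, hπ', hne'⟩, h⟩
    simp [hzero] at this
  refine log_le_of_le_mul_log hL0 hk hdk ?_
  have h1 : (P.card : ℝ) ≤ (2 * k * L + 2) ^ d := by
    have e1 : (P.card : ℝ) ≤ ((m : ℝ) + 1) ^ d := by exact_mod_cast hcard
    refine e1.trans ?_
    have := Nat.floor_le (show 0 ≤ 2 * k * L by positivity)
    refine pow_le_pow_left₀ (by positivity) ?_ d
    rw [hm]
    push_cast
    linarith
  calc L ≤ Real.log ((2 * k * L + 2) ^ d) := Real.log_le_log hN h1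
    _ = _ := Real.log_pow _ _

/-- A class of VC dimension `d` has a `1/k`-cover with logarithm of the size `O(d log k)`, provided
that `d ≤ k`. -/
theorem exists_cover (hA : Nat.card A = 2) {Pol : Set (S → A)} {d : ℕ} (hd : vcDim Pol = d)
    (β : PMF S) {k : ℝ} (hk : 2 ≤ k) (hdk : d ≤ k) :
    ∃ P : Finset (S → A), Real.log P.card ≤ 10 * (d * Real.log k) ∧
      ∀ π ∈ Pol, ∃ π' ∈ P, β.toOuterMeasure {s | π s ≠ π' s} ≤ ENNReal.ofReal (1 / k) := by
  classical
  by_contra! hno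
  -- Packings are small enough to be candidate covers. If none covers, each extends by a far policy,
  -- so packings of every size exist, against the size bound.
  have hpack : ∀ n : ℕ, ∃ P : Finset (S → A), P.card = n ∧ ↑P ⊆ Pol ∧
      ∀ π ∈ P, ∀ π' ∈ P, π ≠ π' →
        ENNReal.ofReal (1 / k) < β.toOuterMeasure {s | π s ≠ π' s} := by
    intro n
    induction n with
    | zero => exact ⟨∅, by simp⟩
    | succ n ih =>
      obtain ⟨P, rfl, hP, hsep⟩ := ih
      obtain ⟨π, hπ, hfar⟩ := hno P (log_card_packing_le hA hd β hk hdk hP hsep)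
      have hnot : π ∉ P := fun h => by simpa using hfar π h
      refine ⟨insert π P, Finset.card_insert_of_notMem hnot, ?_, ?_⟩
      · rw [Finset.coe_insert]
        exact Set.insert_subset hπ hP
      · intro x hx y hy hxy
        rcases Finset.mem_insert.1 hx with rfl | hx' <;>
          rcases Finset.mem_insert.1 hy with rfl | hy'
        · exact absurd rfl hxy
        · exact hfar y hy'
        · simpa only [ne_comm] using hfar x hx'
        · exact hsep x hx' y hy' hxy
  obtain ⟨n, hn⟩ := exists_nat_gt (Real.exp (10 * (d * Real.log k)))
  obtain ⟨P, rfl, hP, hsep⟩ := hpack n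
  have h1 := log_card_packing_le hA hd β hk hdk hP hsep
  rw [Real.log_le_iff_le_exp ((Real.exp_pos _).trans hn)] at h1
  linarith

end Covering

end ActiveLearning

/-! ### Regret bounds in the two cases. -/

namespace ActiveLearning

section Bounds

variable {S A : Type*} [Nonempty A] {Pol : Set (S → A)} {d T : ℕ} {k : ℝ}

theorem bounds_of_littlestoneDim (hA : Nat.card A = 2) (hd : littlestoneDim Pol = d)
    (hk : 0 < k) {p : NNReal} {hp : p ≤ 1} (hpT : (p : ℝ) * T = k) {V : Adversary S A}
    (hreal : Realizable Pol T (fixedRate (standardOptimal Pol) p hp) V) :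
    regret Pol T (fixedRate (standardOptimal Pol) p hp) V binaryLoss ≤
        40 * (T / k * (d * Real.log (k + 1))) ∧
      (2 ≤ k → regret Pol T (fixedRate (standardOptimal Pol) p hp) V binaryLoss ≤
        40 * (T / k * (d * Real.log k))) := by
  have hPol : Pol.Nonempty := let ⟨π, hπ, _⟩ := hreal; ⟨π, hπ⟩
  have hT : (0 : ℝ) < T := by
    rcases (Nat.cast_nonneg T : (0 : ℝ) ≤ T).lt_or_eq with h | h
    · exact h
    · rw [← h, mul_zero] at hpT; linarith
  have hp0 : 0 < p := by
    rcases p.2.lt_or_eq with h | h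
    · exact h
    · have h' : (p : ℝ) = 0 := h.symm
      rw [h', zero_mul] at hpT; linarith
  have h1 : regret Pol T (fixedRate (standardOptimal Pol) p hp) V binaryLoss ≤ d / p :=
    regret_fixedRate_le hPol hp0 (Nat.cast_nonneg d)
      (by simpa using meanTotal_queriedMistake_standardOptimal hA hd hreal)
  have h2 : (d : ℝ) / p = T / k * d := by
    have : (p : ℝ) ≠ 0 := by exact_mod_cast hp0.ne'
    rw [← hpT]
    field_simp
  rw [h2] at h1
  have hTk : 0 < T / k := div_pos hT hk
  have hl2 := Real.log_two_gt_d9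
  have key : ∀ x : ℝ, 2 ≤ x → T / k * d ≤ 40 * (T / k * (d * Real.log x)) := fun x hx => by
    have h3 : Real.log 2 ≤ Real.log x := Real.log_le_log (by norm_num) hx
    calc T / k * d = T / k * (d * 1) := by ring
      _ ≤ T / k * (d * (40 * Real.log x)) := by
          gcongr
          linarith
      _ = _ := by ring
  refine ⟨?_, fun hk2 => h1.trans (key k hk2)⟩
  rcases le_or_gt 1 k with hk1 | hk1
  · exact h1.trans (key (k + 1) (by linarith))
  -- For `k < 1`, `log (k + 1)` is of order `k`, so the bound `d * T/k` is too weak and the horizon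
  -- `T` is used. This requires `d ≥ 1`; for `d = 0` both sides must vanish.
  · rcases Nat.eq_zero_or_pos d with rfl | hd0
    · simpa using h1
    · refine (regret_le_horizon hPol).trans ?_
      have h3 := Real.one_sub_inv_le_log_of_pos (show 0 < k + 1 by linarith)
      have h4 : k ≤ 40 * Real.log (k + 1) := by
        have : k / 2 ≤ 1 - (k + 1)⁻¹ := by
          rw [show 1 - (k + 1)⁻¹ = k / (k + 1) by field_simp; ring]
          gcongr
          linarith
        linarith
      have h5 : (1 : ℝ) ≤ d := by exact_mod_cast hd0
      calc (T : ℝ) = T / k * (1 * k) := by field_simp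
        _ ≤ T / k * (d * (40 * Real.log (k + 1))) := by gcongr
        _ = _ := by ring

theorem exists_rule_of_vcDim (hA : Nat.card A = 2) (hd : vcDim Pol = d) (β : PMF S) {σ : ℝ}
    (hσ0 : 0 < σ) (hσ1 : σ ≤ 1) (hk : 0 < k) {p : NNReal} (hp : p ≤ 1)
    (hpT : (p : ℝ) * T = k) :
    ∃ f : History S A → S → A, ∀ V : Adversary S A, V.IsSmooth β σ →
      Realizable Pol T (fixedRate f p hp) V →
        regret Pol T (fixedRate f p hp) V binaryLoss ≤
            40 * (T / k * (d * Real.log (k + 1) + σ⁻¹)) ∧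
          (2 ≤ k → regret Pol T (fixedRate f p hp) V binaryLoss ≤
            40 * (T / k * (d * Real.log k + σ⁻¹))) := by
  have hTk : 0 ≤ T / k := by positivity
  have hσ : 1 ≤ σ⁻¹ := (one_le_inv₀ hσ0).2 hσ1
  have hl2 := Real.log_two_gt_d9
  -- For `k < 2` the term `σ⁻¹ ≥ 1` alone makes the claim weaker than regret at most `T`, so any
  -- rule works.
  rcases lt_or_ge k 2 with hk2 | hk2
  · refine ⟨Classical.arbitrary _, fun V _ hreal => ⟨?_, fun h => absurd h hk2.not_ge⟩⟩
    obtain ⟨π, hπ, -⟩ := hreal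
    refine (regret_le_horizon ⟨π, hπ⟩).trans ?_
    have h1 : 0 ≤ d * Real.log (k + 1) :=
      mul_nonneg (Nat.cast_nonneg d) (Real.log_nonneg (by linarith))
    calc (T : ℝ) = T / k * k := by field_simp
      _ ≤ T / k * (40 * (d * Real.log (k + 1) + σ⁻¹)) := by
          gcongr
          linarith
      _ = _ := by ring
  have hlog : Real.log 2 ≤ Real.log k := Real.log_le_log (by norm_num) hk2
  suffices h : ∃ f : History S A → S → A, ∀ V : Adversary S A, V.IsSmooth β σ →
      Realizable Pol T (fixedRate f p hp) V →
        regret Pol T (fixedRate f p hp) V binaryLoss ≤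
          40 * (T / k * (d * Real.log k + σ⁻¹)) by
    obtain ⟨f, hf⟩ := h
    refine ⟨f, fun V hV hreal => ⟨(hf V hV hreal).trans ?_, fun _ => hf V hV hreal⟩⟩
    gcongr
    linarith
  -- For `k < d` the term `d log k ≥ k log 2` again makes the horizon bound enough; the cover needs
  -- `d ≤ k`.
  rcases lt_or_ge k d with hdk | hdk
  · refine ⟨Classical.arbitrary _, fun V _ hreal => ?_⟩
    obtain ⟨π, hπ, -⟩ := hreal
    refine (regret_le_horizon ⟨π, hπ⟩).trans ?_
    have h1 : k * Real.log 2 ≤ d * Real.log k := by gcongr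
    calc (T : ℝ) = T / k * k := by field_simp
      _ ≤ T / k * (40 * (d * Real.log k + σ⁻¹)) := by
          gcongr
          nlinarith
      _ = _ := by ring
  obtain ⟨P, hPcard, hP⟩ := exists_cover hA hd β hk2 hdk
  have : Finite A := Nat.finite_of_card_ne_zero (by omega)
  refine ⟨weightedMajority P, fun V hV hreal => ?_⟩
  have hPol : Pol.Nonempty := let ⟨π, hπ, _⟩ := hreal; ⟨π, hπ⟩
  have hp0 : 0 < p := by
    rcases p.2.lt_or_eq with h | h
    · exact h
    · have h' : (p : ℝ) = 0 := h.symm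
      rw [h', zero_mul] at hpT; linarith
  have h1 := meanTotal_queriedMistake_weightedMajority hσ0 (by positivity) hV hP hreal
  have hlogP : 0 ≤ Real.log P.card := Real.log_natCast_nonneg _
  have h2 := regret_fixedRate_le hPol hp0 (by positivity) h1
  refine h2.trans ?_
  have hp' : (p : ℝ) ≠ 0 := by exact_mod_cast hp0.ne'
  have hT : (T : ℝ) ≠ 0 := by
    rintro h
    rw [h, mul_zero] at hpT; linarith
  have h3 : T * (p * (1 / σ * (1 / k))) = σ⁻¹ := by
    rw [← hpT]
    field_simp
  have h4 : ∀ x : ℝ, x / p = T / k * x := fun x => by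
    rw [← hpT]
    field_simp
  rw [h3, h4]
  calc T / k * (4 * Real.log P.card + 3 * σ⁻¹) ≤
        T / k * (40 * (d * Real.log k + σ⁻¹)) := by
        gcongr
        linarith
    _ = _ := by ring

end Bounds

end ActiveLearning

open ActiveLearning in
theorem corollary2p4 :
    ∃ C : ℝ, 0 < C ∧
      ∀ (S : Type*) [Countable S] (A : Type*) (_hA : Nat.card A = 2)
        (Pol : Set (S → A)) (β : PMF S) (d : ℕ) (σ : ℝ)
        (_hdim : (vcDim Pol = d ∧ 0 < σ ∧ σ ≤ 1) ∨ (littlestoneDim Pol = d ∧ σ = 0))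
        (T : ℕ) (k : ℝ) (_hk0 : 0 < k) (_hkT : k ≤ T),
        ∃ Γ : Algorithm S A, Γ.QueryAgnostic ∧
          ∀ V : Adversary S A, V.IsSmooth β σ → Realizable Pol T Γ V →
            expectedQueries T Γ V = k ∧
            regret Pol T Γ V binaryLoss ≤ C * (T / k * (d * Real.log (k + 1) + σ⁻¹)) ∧
            (2 ≤ k →
              regret Pol T Γ V binaryLoss ≤ C * (T / k * (d * Real.log k + σ⁻¹))) := by
  -- The constant is `4 * 10`: weighted majority times the logarithmic size of the cover.
  refine ⟨40, by norm_num, fun S _ A hA Pol β d σ hdim T k hk hkT => ?_⟩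
  have : Nonempty A := (Nat.card_pos_iff.1 (by omega)).1
  have hT : (0 : ℝ) < T := hk.trans_le hkT
  obtain ⟨p, hp, hpT⟩ : ∃ p : NNReal, p ≤ 1 ∧ (p : ℝ) * T = k :=
    ⟨⟨k / T, by positivity⟩, (div_le_one hT).2 hkT, div_mul_cancel₀ k hT.ne'⟩
  rcases hdim with ⟨hd, hσ0, hσ1⟩ | ⟨hd, rfl⟩
  · obtain ⟨f, hf⟩ := exists_rule_of_vcDim hA hd β hσ0 hσ1 hk hp hpT
    exact ⟨fixedRate f p hp, fixedRate_queryAgnostic f p hp, fun V hV hreal =>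
      ⟨(expectedQueries_fixedRate T).trans hpT, hf V hV hreal⟩⟩
  · refine ⟨fixedRate (standardOptimal Pol) p hp, fixedRate_queryAgnostic _ p hp,
      fun V _ hreal => ⟨(expectedQueries_fixedRate T).trans hpT, ?_⟩⟩
    -- Here `σ = 0`, and `0⁻¹ = 0` agrees with the convention for `σ⁺`.
    simpa using bounds_of_littlestoneDim hA hd hk hpT hreal
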